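/- Let $\mathbb F$ be $\mathbb R$ or $\mathbb C$, and let $\mathcal H$ and $\mathcal K$ be Hilbert spaces over $\mathbb F$, with inner product $\langle\cdot|\cdot\rangle$ linear in the second variable. Let $\mathscr B(\mathcal H,\mathcal K)$ be the space of bounded $\mathbb F$-linear operators from $\mathcal H$ to $\mathcal K$ with the operator norm, and $\mathscr K(\mathcal H,\mathcal K)$ its subspace of compact operators. Let $A\in\mathscr B(\mathcal H,\mathcal K)$ satisfy $\operatorname{dist}(A,\mathscr K(\mathcal H,\mathcal K))=\inf\{\|A-T\| : T\in\mathscr K(\mathcal H,\mathcal K)\}<\|A\|$, and let $\mathcal B$ be an $\mathbb F$-linear subspace (not necessarily closed) of $\mathscr B(\mathcal H,\mathcal K)$. Then $A$ is Birkhoff–James orthogonal to $\mathcal B$, that is, $\|A\|\le\|A+B\|$ for all $B\in\mathcal B$, if and only if there exist an at most countable index set $\mathcal J$, positive real numbers $s_j$ $(j\in\mathcal J)$ and an orthonormal family $(u_j)_{j\in\mathcal J}$ in $\mathcal H$ such that (i) $\sum_{j\in\mathcal J}s_j=1$; (ii) $A^*Au_j=\|A\|^2u_j$ for each $j\in\mathcal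 J$; (iii) $\sum_{j\in\mathcal J}s_j\langle Au_j\,|\,Bu_j\rangle=0$ for all $B\in\mathcal B$. -/

import Mathlib

/-- A vector `v` of a normed space `V` over `𝕜` is Birkhoff–James orthogonal to a linear subspace
`W` if `‖v‖ ≤ ‖v + w‖` for all `w ∈ W`. -/
def BirkhoffJamesOrthogonal {𝕜 V : Type*} [NormedField 𝕜] [NormedAddCommGroup V]
    [NormedSpace 𝕜 V] (v : V) (W : Submodule 𝕜 V) : Prop :=
  ∀ w ∈ W, ‖v‖ ≤ ‖v + w‖

/-! A compact operator closer to `A` than `‖A‖` makes `M = ker (A† A - ‖A‖ ^ 2)` finite-dimensional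
and lets norm-maximising sequences converge, along a subsequence, to vectors of `M`. If `A` is
orthogonal to `B`, near-maximisers of `A - t B` as `t → 0` thus yield a unit `u ∈ M` with `re ⟪A u,
B u⟫ ≤ 0`. Compressing each `A† B` to `M` leaves a finite-dimensional problem: by Hahn–Banach, `0`
is a convex combination of vector states, and diagonalising its density operator makes the vectors
orthonormal. The converse is Cauchy–Schwarz. -/

open Filter Topology ContinuousLinearMap

/-! ### Near-maximisers and the eigenspace of `A† A` -/

section Operators

variable {𝕜 H K : Type*} [RCLike 𝕜]
  [NormedAddCommGroup H] [InnerProductSpace 𝕜 H] [CompleteSpace H]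
  [NormedAddCommGroup K] [InnerProductSpace 𝕜 K] [CompleteSpace K]

/-- If `A` is closer than `‖A‖` to a compact operator, then every bounded sequence of approximate
eigenvectors of `A† A` for `‖A‖ ^ 2` has a convergent subsequence. -/
theorem exists_tendsto_subseq_of_tendsto_adjoint_apply_sub {A T : H →L[𝕜] K}
    (hT : IsCompactOperator T) (hAT : ‖A - T‖ < ‖A‖) {x : ℕ → H} (hx : ∀ n, ‖x n‖ ≤ 1)
    (hlim : Tendsto (fun n => adjoint A (A (x n)) - ((‖A‖ ^ 2 : ℝ) : 𝕜) • x n) atTop (𝓝 0)) :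
    ∃ (a : H) (φ : ℕ → ℕ), StrictMono φ ∧ Tendsto (x ∘ φ) atTop (𝓝 a) := by
  have hA : 0 < ‖A‖ := (norm_nonneg _).trans_lt hAT
  obtain ⟨C, hC, hTC⟩ := IsCompactOperator.image_closedBall_subset_compact
    (f := (T : H →ₗ[𝕜] K)) hT 1
  obtain ⟨y, -, φ, hφ, hy⟩ := hC.tendsto_subseq (x := fun n => T (x n))
    fun n => hTC ⟨x n, by simpa using hx n, rfl⟩
  -- `R = A† T - (A† A - ‖A‖ ^ 2)`, so `R x` converges wherever `T x` does; being bounded below, `R`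
  -- passes the Cauchy property back to `x`.
  set R : H →L[𝕜] H :=
    ((‖A‖ ^ 2 : ℝ) : 𝕜) • ContinuousLinearMap.id 𝕜 H - (adjoint A).comp (A - T) with hR
  have hRlim : Tendsto (fun n => R (x (φ n))) atTop (𝓝 (adjoint A y)) := by
    have h1 := (((adjoint A).continuous.tendsto y).comp hy).sub (hlim.comp hφ.tendsto_atTop)
    rw [sub_zero] at h1
    refine h1.congr fun n => ?_
    simp only [hR, Function.comp_apply, sub_apply,
      smul_apply, ContinuousLinearMap.id_apply,
      ContinuousLinearMap.comp_apply, map_sub]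
    abel
  have hpos : 0 < ‖A‖ ^ 2 - ‖A‖ * ‖A - T‖ := by nlinarith
  have hbound : ∀ z, ‖z‖ ≤ (⟨(‖A‖ ^ 2 - ‖A‖ * ‖A - T‖)⁻¹, by positivity⟩ : NNReal) * ‖R z‖ := by
    intro z
    have h1 : ‖adjoint A ((A - T) z)‖ ≤ ‖A‖ * ‖A - T‖ * ‖z‖ := by
      calc _ ≤ ‖adjoint A‖ * ‖(A - T) z‖ := le_opNorm _ _
        _ ≤ ‖A‖ * (‖A - T‖ * ‖z‖) := by
          rw [LinearIsometryEquiv.norm_map]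
          gcongr
          exact le_opNorm _ _
        _ = _ := by ring
    have h2 : ‖((‖A‖ ^ 2 : ℝ) : 𝕜) • z‖ = ‖A‖ ^ 2 * ‖z‖ := by
      rw [norm_smul, RCLike.norm_ofReal, abs_of_nonneg (by positivity)]
    have h3 : ‖((‖A‖ ^ 2 : ℝ) : 𝕜) • z‖ - ‖adjoint A ((A - T) z)‖ ≤ ‖R z‖ :=
      norm_sub_norm_le _ _
    change ‖z‖ ≤ (‖A‖ ^ 2 - ‖A‖ * ‖A - T‖)⁻¹ * ‖R z‖
    rw [inv_mul_eq_div, le_div_iff₀ hpos]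
    nlinarith
  have hcauchy : CauchySeq (x ∘ φ) :=
    ((R.antilipschitz_of_bound hbound).isUniformInducing R.uniformContinuous).cauchy_map_iff.1
      (by rw [Filter.map_map]; exact hRlim.cauchySeq)
  obtain ⟨a, ha⟩ := cauchySeq_tendsto_of_complete hcauchy
  exact ⟨a, φ, hφ, ha⟩

/-- Expanding the square shows that unit vectors nearly attaining the norm are approximate
eigenvectors. -/
theorem norm_adjoint_apply_sub_sq_le (A : H →L[𝕜] K) {x : H} (hx : ‖x‖ = 1) :
    ‖adjoint A (A x) - ((‖A‖ ^ 2 : ℝ) : 𝕜) • x‖ ^ 2 ≤ ‖A‖ ^ 2 * (‖A‖ ^ 2 - ‖A x‖ ^ 2) := by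
  have h1 : ‖adjoint A (A x)‖ ≤ ‖A‖ * ‖A x‖ := by
    simpa using (adjoint A).le_opNorm (A x)
  have h2 : ‖((‖A‖ ^ 2 : ℝ) : 𝕜) • x‖ = ‖A‖ ^ 2 := by
    rw [norm_smul, RCLike.norm_ofReal, abs_of_nonneg (by positivity), hx, mul_one]
  have h3 : RCLike.re (inner 𝕜 (adjoint A (A x)) (((‖A‖ ^ 2 : ℝ) : 𝕜) • x))
      = ‖A‖ ^ 2 * ‖A x‖ ^ 2 := by
    rw [inner_smul_right, adjoint_inner_left, RCLike.re_ofReal_mul, inner_self_eq_norm_sq]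
  rw [@norm_sub_sq 𝕜, h2, h3]
  have h4 : ‖adjoint A (A x)‖ ^ 2 ≤ (‖A‖ * ‖A x‖) ^ 2 := by gcongr
  nlinarith

/-- The space of vectors at which `A` attains its norm. -/
noncomputable def normAttainingSpace (A : H →L[𝕜] K) : Submodule 𝕜 H :=
  ((adjoint A).comp A - ((‖A‖ ^ 2 : ℝ) : 𝕜) • ContinuousLinearMap.id 𝕜 H).ker

theorem mem_normAttainingSpace {A : H →L[𝕜] K} {x : H} :
    x ∈ normAttainingSpace A ↔ adjoint A (A x) = ((‖A‖ ^ 2 : ℝ) : 𝕜) • x := by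
  simp [normAttainingSpace, sub_eq_zero]

theorem finiteDimensional_normAttainingSpace {A T : H →L[𝕜] K}
    (hT : IsCompactOperator T) (hAT : ‖A - T‖ < ‖A‖) :
    FiniteDimensional 𝕜 (normAttainingSpace A) := by
  refine FiniteDimensional.of_isCompact_closedBall₀ 𝕜 one_pos
    (isCompact_iff_isSeqCompact.2 fun x hx => ?_)
  obtain ⟨a, φ, hφ, ha⟩ := exists_tendsto_subseq_of_tendsto_adjoint_apply_sub hT hAT
    (x := fun n => (x n : H)) (fun n => by simpa using hx n)
    (by simp [mem_normAttainingSpace.1 (x _).2])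
  have haM : a ∈ normAttainingSpace A :=
    (ContinuousLinearMap.isClosed_ker _).mem_of_tendsto ha (.of_forall fun n => (x (φ n)).2)
  have ha' : Tendsto (x ∘ φ) atTop (𝓝 ⟨a, haM⟩) := tendsto_subtype_rng.2 ha
  exact ⟨_, Metric.isClosed_closedBall.mem_of_tendsto ha' (.of_forall fun n => hx _), φ, hφ, ha'⟩

/-- If `‖A‖ ≤ ‖A + t B‖` for all real `t`, then `B` is not strictly positive along `A` on the unit
sphere of the norm attaining space. -/
theorem exists_re_inner_apply_nonpos {A B T : H →L[𝕜] K}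
    (hT : IsCompactOperator T) (hAT : ‖A - T‖ < ‖A‖)
    (hB : ∀ t : ℝ, ‖A‖ ≤ ‖A + (t : 𝕜) • B‖) :
    ∃ u ∈ normAttainingSpace A, ‖u‖ = 1 ∧ RCLike.re (inner 𝕜 (A u) (B u)) ≤ 0 := by
  have hA : 0 < ‖A‖ := (norm_nonneg _).trans_lt hAT
  set t : ℕ → ℝ := fun n => 1 / ((n : ℝ) + 1) with ht_def
  have ht0 : ∀ n, 0 < t n := fun n => by positivity
  have ht : Tendsto t atTop (𝓝 0) := tendsto_one_div_add_atTop_nhds_zero_nat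
  -- The error `t n ^ 2` is of smaller order than `t n`, so it survives the later division by `t n`.
  have hx : ∀ n, ∃ x : H, ‖x‖ = 1 ∧ ‖A‖ - t n ^ 2 < ‖(A + ((-t n : ℝ) : 𝕜) • B) x‖ := by
    intro n
    have hlt : max 0 (‖A‖ - t n ^ 2) < ‖A + ((-t n : ℝ) : 𝕜) • B‖ :=
      (max_lt hA (by have := ht0 n; nlinarith)).trans_le (hB _)
    obtain ⟨x, hx⟩ := exists_mul_lt_of_lt_opNorm _ (le_max_left _ _) hlt
    have hx0 : 0 < ‖x‖ := by
      rcases (norm_nonneg x).eq_or_lt with h | h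
      · rw [norm_eq_zero.1 h.symm] at hx
        simp at hx
      · exact h
    refine ⟨((‖x‖⁻¹ : ℝ) : 𝕜) • x, ?_, (le_max_right 0 _).trans_lt ?_⟩
    · rw [norm_smul, RCLike.norm_ofReal, abs_of_nonneg (by positivity), inv_mul_cancel₀ hx0.ne']
    · rw [map_smul, norm_smul, RCLike.norm_ofReal, abs_of_nonneg (by positivity), inv_mul_eq_div,
        lt_div_iff₀ hx0]
      exact hx
  choose x hx1 hx using hx
  have hBx : ∀ n, ‖B (x n)‖ ≤ ‖B‖ := fun n => by simpa [hx1 n] using B.le_opNorm (x n)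
  have hAx : ∀ n, ‖A (x n)‖ ≤ ‖A‖ := fun n => by simpa [hx1 n] using A.le_opNorm (x n)
  have happ : ∀ n, (A + ((-t n : ℝ) : 𝕜) • B) (x n) = A (x n) - ((t n : ℝ) : 𝕜) • B (x n) := by
    intro n
    simp [sub_eq_add_neg]
  have hnorm : ∀ n, ‖((t n : ℝ) : 𝕜) • B (x n)‖ ≤ t n * ‖B‖ := fun n => by
    rw [norm_smul, RCLike.norm_ofReal, abs_of_pos (ht0 n)]
    exact mul_le_mul_of_nonneg_left (hBx n) (ht0 n).le
  have hAlim : Tendsto (fun n => ‖A (x n)‖) atTop (𝓝 ‖A‖) := by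
    have hl : Tendsto (fun n => ‖A‖ - t n ^ 2 - t n * ‖B‖) atTop (𝓝 ‖A‖) := by
      simpa using ((tendsto_const_nhds (x := ‖A‖)).sub (ht.pow 2)).sub (ht.mul_const ‖B‖)
    refine tendsto_of_tendsto_of_tendsto_of_le_of_le hl tendsto_const_nhds (fun n => ?_) hAx
    have h1 := hx n
    rw [happ] at h1
    have h2 := norm_sub_le (A (x n)) (((t n : ℝ) : 𝕜) • B (x n))
    have h3 := hnorm n
    change ‖A‖ - t n ^ 2 - t n * ‖B‖ ≤ ‖A (x n)‖
    linarith
  have heig : Tendsto (fun n => adjoint A (A (x n)) - ((‖A‖ ^ 2 : ℝ) : 𝕜) • x n) atTop (𝓝 0) := by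
    rw [tendsto_zero_iff_norm_tendsto_zero]
    have h1 : Tendsto (fun n => √(‖A‖ ^ 2 * (‖A‖ ^ 2 - ‖A (x n)‖ ^ 2))) atTop (𝓝 0) := by
      have h2 := (((tendsto_const_nhds (x := ‖A‖ ^ 2)).sub (hAlim.pow 2)).const_mul
        (‖A‖ ^ 2)).sqrt
      rwa [sub_self, mul_zero, Real.sqrt_zero] at h2
    exact squeeze_zero (fun _ => norm_nonneg _)
      (fun n => Real.le_sqrt_of_sq_le (norm_adjoint_apply_sub_sq_le A (hx1 n))) h1
  obtain ⟨u, φ, hφ, hu⟩ :=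
    exists_tendsto_subseq_of_tendsto_adjoint_apply_sub hT hAT (fun n => (hx1 n).le) heig
  have hAu : Tendsto (fun n => A (x (φ n))) atTop (𝓝 (A u)) := (A.continuous.tendsto u).comp hu
  have hBu : Tendsto (fun n => B (x (φ n))) atTop (𝓝 (B u)) := (B.continuous.tendsto u).comp hu
  refine ⟨u, ?_, ?_, ?_⟩
  · rw [mem_normAttainingSpace, ← sub_eq_zero]
    refine tendsto_nhds_unique ?_ (heig.comp hφ.tendsto_atTop)
    exact (((adjoint A).continuous.tendsto _).comp hAu).sub (hu.const_smul _)
  · exact tendsto_nhds_unique hu.norm (tendsto_const_nhds.congr fun n => (hx1 _).symm)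
  · have hre : Tendsto (fun n => RCLike.re (inner 𝕜 (A (x (φ n))) (B (x (φ n))))) atTop
        (𝓝 (RCLike.re (inner 𝕜 (A u) (B u)))) :=
      (RCLike.continuous_re.tendsto _).comp (hAu.inner hBu)
    -- This bound on `re ⟪A x, B x⟫` comes from squaring `‖A‖ - t ^ 2 < ‖A x - t B x‖` and dividing
    -- by `2 t`.
    have hright : Tendsto (fun n => t (φ n) * (‖B‖ ^ 2 / 2 + ‖A‖)) atTop (𝓝 0) := by
      simpa using (ht.comp hφ.tendsto_atTop).mul_const (‖B‖ ^ 2 / 2 + ‖A‖)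
    have key : ∀ᶠ n in atTop, t n ^ 2 < ‖A‖ := by
      have : Tendsto (fun n => t n ^ 2) atTop (𝓝 0) := by simpa using ht.pow 2
      exact this.eventually_lt_const hA
    refine le_of_tendsto_of_tendsto hre hright ?_
    filter_upwards [hφ.tendsto_atTop.eventually key] with n hn
    generalize φ n = m at hn ⊢
    have h1 := hx m
    rw [happ] at h1
    have h2 : (‖A‖ - t m ^ 2) ^ 2 ≤ ‖A (x m) - ((t m : ℝ) : 𝕜) • B (x m)‖ ^ 2 :=
      pow_le_pow_left₀ (by linarith) h1.le 2
    rw [@norm_sub_sq 𝕜, inner_smul_right, RCLike.re_ofReal_mul] at h2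
    have h3 : ‖((t m : ℝ) : 𝕜) • B (x m)‖ ^ 2 ≤ (t m * ‖B‖) ^ 2 := by
      gcongr
      exact hnorm m
    have h4 : ‖A (x m)‖ ^ 2 ≤ ‖A‖ ^ 2 := by
      gcongr
      exact hAx m
    refine le_of_mul_le_mul_left ?_ (ht0 m)
    nlinarith [sq_nonneg (t m ^ 2)]

end Operators

/-! ### States on a finite-dimensional space -/

section FiniteDimensional

variable {𝕜 M : Type*} [RCLike 𝕜] [NormedAddCommGroup M] [InnerProductSpace 𝕜 M]
  [FiniteDimensional 𝕜 M]

/-- A finite convex combination of vector states on a finite-dimensional space is a convex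
combination of the vector states of an orthonormal basis. -/
theorem exists_orthonormalBasis_sum_inner_eq {ι : Type*} [Fintype ι] {w : ι → ℝ}
    (hw : ∀ i, 0 ≤ w i) (hw1 : ∑ i, w i = 1) {z : ι → M} (hz : ∀ i, ‖z i‖ = 1) :
    ∃ (e : OrthonormalBasis (Fin (Module.finrank 𝕜 M)) 𝕜 M)
      (l : Fin (Module.finrank 𝕜 M) → ℝ), l ∈ stdSimplex ℝ (Fin (Module.finrank 𝕜 M)) ∧
      ∀ X : M →ₗ[𝕜] M, ∑ i, (w i : 𝕜) * inner 𝕜 (z i) (X (z i))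
        = ∑ j, (l j : 𝕜) * inner 𝕜 (e j) (X (e j)) := by
  -- The density operator: both sums equal `tr (ρ X)`, and `X = id` gives total weight `1`.
  let ρ : M →ₗ[𝕜] M := ∑ i, (w i : 𝕜) • ((innerₛₗ 𝕜 (z i)).smulRight (z i))
  have hρ : ∀ x, ρ x = ∑ i, (w i : 𝕜) • inner 𝕜 (z i) x • z i := fun x => by
    simp [ρ]
  have hsymm : ρ.IsSymmetric := by
    intro x y
    simp only [hρ, sum_inner, inner_sum, inner_smul_left, inner_smul_right, RCLike.conj_ofReal,
      inner_conj_symm]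
    exact Finset.sum_congr rfl fun i _ => by ring
  let e := hsymm.eigenvectorBasis rfl
  let l := hsymm.eigenvalues rfl
  have he : ∀ j, ρ (e j) = (l j : 𝕜) • e j := hsymm.apply_eigenvectorBasis rfl
  have htr : ∀ X : M →ₗ[𝕜] M, ∑ i, (w i : 𝕜) * inner 𝕜 (z i) (X (z i))
      = ∑ j, (l j : 𝕜) * inner 𝕜 (e j) (X (e j)) := by
    intro X
    calc ∑ i, (w i : 𝕜) * inner 𝕜 (z i) (X (z i))
        = ∑ i, (w i : 𝕜) * inner 𝕜 (LinearMap.adjoint X (z i)) (z i) := by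
          simp only [LinearMap.adjoint_inner_left]
      _ = ∑ i, ∑ j, (w i : 𝕜) * (inner 𝕜 (z i) (X (e j)) * inner 𝕜 (e j) (z i)) := by
          simp only [← e.sum_inner_mul_inner (LinearMap.adjoint X (z _)) (z _), Finset.mul_sum,
            LinearMap.adjoint_inner_left]
      _ = ∑ j, inner 𝕜 (ρ (e j)) (X (e j)) := by
          rw [Finset.sum_comm]
          refine Finset.sum_congr rfl fun j _ => ?_
          simp only [hρ, sum_inner, inner_smul_left, RCLike.conj_ofReal, inner_conj_symm]
          exact Finset.sum_congr rfl fun i _ => by ring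
      _ = _ := by
          simp only [he, inner_smul_left, RCLike.conj_ofReal]
  refine ⟨e, l, ⟨fun j => ?_, ?_⟩, htr⟩
  · have h1 : (l j : 𝕜) = ∑ i, ((w i * ‖inner 𝕜 (z i) (e j)‖ ^ 2 : ℝ) : 𝕜) := by
      have h2 : inner 𝕜 (e j) (ρ (e j)) = (l j : 𝕜) := by
        rw [he, inner_smul_right, e.inner_eq_one, mul_one]
      rw [← h2, hρ, inner_sum]
      refine Finset.sum_congr rfl fun i _ => ?_
      rw [inner_smul_right, inner_smul_right, ← inner_conj_symm (e j) (z i), RCLike.mul_conj]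
      push_cast
      rfl
    rw [← RCLike.ofReal_sum, RCLike.ofReal_inj] at h1
    rw [h1]
    exact Finset.sum_nonneg fun i _ => mul_nonneg (hw i) (by positivity)
  · have h1 := htr LinearMap.id
    simp only [LinearMap.id_apply, inner_self_eq_norm_sq_to_K, hz, e.norm_eq_one] at h1
    simp only [RCLike.ofReal_one, one_pow, mul_one, ← RCLike.ofReal_sum, RCLike.ofReal_inj] at h1
    exact h1.symm.trans hw1

theorem isCompact_setOf_orthonormal (ι : Type*) [Fintype ι] :
    IsCompact {e : ι → M | Orthonormal 𝕜 e} := by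
  classical
  have := FiniteDimensional.proper_rclike 𝕜 M
  refine Metric.isCompact_of_isClosed_isBounded ?_ ?_
  · simp only [orthonormal_iff_ite, Set.ofPred_forall]
    exact isClosed_iInter fun i => isClosed_iInter fun j =>
      isClosed_eq (by fun_prop) continuous_const
  · refine Metric.isBounded_closedBall (x := 0) (r := 1) |>.subset fun e he => ?_
    rw [mem_closedBall_zero_iff, pi_norm_le_iff_of_nonneg zero_le_one]
    exact fun i => (he.1 i).le

/-- Orthonormal bases bound the number of terms by `finrank`, so the hull is a continuous image of
frames times a simplex. -/
theorem isCompact_convexHull_image_sphere {κ : Type*} [Fintype κ] (X : κ → M →ₗ[𝕜] M) :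
    IsCompact (convexHull ℝ
      ((fun u : M => fun k => inner 𝕜 u (X k u)) '' Metric.sphere (0 : M) 1)) := by
  let n := Module.finrank 𝕜 M
  have hX : ∀ k, Continuous (X k) := fun k => (X k).continuous_of_finiteDimensional
  have hcomp : IsCompact ((fun p : (Fin n → M) × (Fin n → ℝ) =>
      fun k => ∑ j, (p.2 j : 𝕜) * inner 𝕜 (p.1 j) (X k (p.1 j))) ''
        ({e | Orthonormal 𝕜 e} ×ˢ stdSimplex ℝ (Fin n))) := by
    refine ((isCompact_setOf_orthonormal (Fin n)).prod (isCompact_stdSimplex ℝ _)).image ?_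
    fun_prop
  convert! hcomp using 1
  ext y
  constructor
  · rw [mem_convexHull_iff_exists_fintype]
    rintro ⟨ι, _, w, q, hw, hw1, hq, rfl⟩
    choose z hz hzq using hq
    obtain ⟨e, l, hl, h⟩ := exists_orthonormalBasis_sum_inner_eq hw hw1
      (z := z) (𝕜 := 𝕜) (fun i => by simpa using hz i)
    refine ⟨(e, l), ⟨e.orthonormal, hl⟩, ?_⟩
    ext k
    simp [← hzq, h, RCLike.real_smul_eq_coe_mul, n]
  · rintro ⟨⟨e, l⟩, ⟨he, hl⟩, rfl⟩
    refine mem_convexHull_of_exists_fintype l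
      (fun j => fun k => inner 𝕜 (e j) (X k (e j))) hl.1 hl.2
      (fun j => ⟨e j, by simpa using he.1 j, rfl⟩) ?_
    ext k
    simp [RCLike.real_smul_eq_coe_mul]

/-- A linear space of operators on a finite-dimensional space, none of which has a strictly
positive real part, is annihilated by some state. -/
theorem exists_orthonormalBasis_sum_inner_eq_zero (W : Submodule 𝕜 (M →ₗ[𝕜] M))
    (hW : ∀ X ∈ W, ∃ u : M, ‖u‖ = 1 ∧ RCLike.re (inner 𝕜 u (X u)) ≤ 0) :
    ∃ (e : OrthonormalBasis (Fin (Module.finrank 𝕜 M)) 𝕜 M)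
      (l : Fin (Module.finrank 𝕜 M) → ℝ), l ∈ stdSimplex ℝ (Fin (Module.finrank 𝕜 M)) ∧
      ∀ X ∈ W, ∑ j, (l j : 𝕜) * inner 𝕜 (e j) (X (e j)) = 0 := by
  let b := Module.finBasis 𝕜 W
  let X : Fin (Module.finrank 𝕜 W) → M →ₗ[𝕜] M := fun k => b k
  have hzero : (0 : Fin (Module.finrank 𝕜 W) → 𝕜) ∈ convexHull ℝ
      ((fun u : M => fun k => inner 𝕜 u (X k u)) '' Metric.sphere (0 : M) 1) := by
    by_contra hnot
    -- The coefficients of a separating `f` assemble an element of `W` with strictly positive real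
    -- part on the sphere, contradicting `hW`.
    obtain ⟨f, c, hc, hf⟩ := RCLike.geometric_hahn_banach_point_closed (𝕜 := 𝕜)
      (convex_convexHull ℝ _) (isCompact_convexHull_image_sphere X).isClosed hnot
    obtain ⟨u, hu, hle⟩ := hW (∑ k, f (Pi.single k 1) • X k)
      (W.sum_mem fun k _ => W.smul_mem _ (b k).2)
    have h1 := hf _ (subset_convexHull ℝ _ ⟨u, by simpa using hu, rfl⟩)
    have h2 : f (fun k => inner 𝕜 u (X k u))
        = inner 𝕜 u ((∑ k, f (Pi.single k 1) • X k) u) := by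
      conv_lhs => rw [pi_eq_sum_univ' (fun k => inner 𝕜 u (X k u))]
      simp [inner_sum, inner_smul_right, mul_comm]
    rw [h2] at h1
    simp only [map_zero] at hc
    linarith
  obtain ⟨ι, _, w, q, hw, hw1, hq, hsum⟩ := mem_convexHull_iff_exists_fintype.1 hzero
  choose z hz hzq using hq
  obtain ⟨e, l, hl, h⟩ := exists_orthonormalBasis_sum_inner_eq hw hw1
    (z := z) (𝕜 := 𝕜) (fun i => by simpa using hz i)
  refine ⟨e, l, hl, fun Y hY => ?_⟩
  have hY' : Y = ∑ k, b.repr ⟨Y, hY⟩ k • X k := by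
    have := congrArg W.subtype (b.sum_repr ⟨Y, hY⟩)
    rw [map_sum] at this
    exact this.symm
  have hk : ∀ k, ∑ j, (l j : 𝕜) * inner 𝕜 (e j) (X k (e j)) = 0 := by
    intro k
    rw [← h]
    have := congrFun hsum k
    simpa [← hzq, RCLike.real_smul_eq_coe_mul] using this
  rw [hY']
  simp only [LinearMap.sum_apply, LinearMap.smul_apply, inner_sum, inner_smul_right,
    Finset.mul_sum]
  rw [Finset.sum_comm]
  refine Finset.sum_eq_zero fun k _ => ?_
  simp only [mul_left_comm _ (b.repr _ k), ← Finset.mul_sum, hk, mul_zero]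

end FiniteDimensional

/-! ### The characterisation of orthogonality -/

theorem mainTheorem5 {𝕜 H K : Type*} [RCLike 𝕜]
    [NormedAddCommGroup H] [InnerProductSpace 𝕜 H] [CompleteSpace H]
    [NormedAddCommGroup K] [InnerProductSpace 𝕜 K] [CompleteSpace K]
    (A : H →L[𝕜] K)
    (hA : Metric.infDist A {T : H →L[𝕜] K | IsCompactOperator T} < ‖A‖)
    (𝓑 : Submodule 𝕜 (H →L[𝕜] K)) :
    BirkhoffJamesOrthogonal A 𝓑 ↔
      ∃ (J : Type) (_ : Countable J) (s : J → ℝ) (u : J → H),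
        (∀ j, 0 < s j) ∧ Orthonormal 𝕜 u ∧
        HasSum s 1 ∧
        (∀ j, ContinuousLinearMap.adjoint A (A (u j)) = ((‖A‖ ^ 2 : ℝ) : 𝕜) • u j) ∧
        (∀ B ∈ 𝓑, HasSum (fun j => (s j : 𝕜) * inner 𝕜 (A (u j)) (B (u j))) 0) := by
  obtain ⟨T, hT, hdist⟩ := (Metric.infDist_lt_iff ⟨0, isCompactOperator_zero⟩).1 hA
  rw [dist_eq_norm] at hdist
  have hA0 : 0 < ‖A‖ := (norm_nonneg _).trans_lt hdist
  constructor
  · intro hBJ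
    have := finiteDimensional_normAttainingSpace hT hdist
    let M := normAttainingSpace A
    let compress : (H →L[𝕜] K) →ₗ[𝕜] (M →ₗ[𝕜] M) :=
      { toFun := fun B => (M.orthogonalProjectionOnto.comp ((adjoint A).comp (B.comp M.subtypeL)))
        map_add' := fun B C => by ext; simp
        map_smul' := fun c B => by ext; simp }
    have hcompress : ∀ (B : H →L[𝕜] K) (u : M),
        inner 𝕜 u (compress B u) = inner 𝕜 (A u) (B u) := by
      intro B u
      simp [compress, adjoint_inner_right]
    obtain ⟨e, l, hl, h⟩ := exists_orthonormalBasis_sum_inner_eq_zero (𝓑.map compress) (by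
      rintro _ ⟨B, hB, rfl⟩
      obtain ⟨u, huM, hu, hle⟩ := exists_re_inner_apply_nonpos hT hdist (B := B)
        fun t => hBJ _ (𝓑.smul_mem _ hB)
      exact ⟨⟨u, huM⟩, hu, by rw [hcompress]; exact hle⟩)
    -- Indices of weight zero are dropped, since the `s j` must be positive.
    have hsupp : Function.support l ⊆ {j | 0 < l j} := fun j hj =>
      lt_of_le_of_ne (hl.1 j) (Ne.symm hj)
    refine ⟨{j // 0 < l j}, inferInstance, fun j => l j, fun j => e j, fun j => j.2, ?_, ?_,
      fun j => mem_normAttainingSpace.1 (e j).2, fun B hB => ?_⟩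
    · exact (e.orthonormal.comp_linearIsometry M.subtypeₗᵢ).comp _ Subtype.val_injective
    · rw [← hl.2]
      exact (hasSum_subtype_iff_of_support_subset hsupp).2 (hasSum_fintype l)
    · have h1 := h _ ⟨B, hB, rfl⟩
      simp only [hcompress] at h1
      rw [← h1]
      refine (hasSum_subtype_iff_of_support_subset (s := {j | 0 < l j})
        (f := fun j => (l j : 𝕜) * inner 𝕜 (A (e j)) (B (e j))) fun j hj => hsupp fun h0 => hj ?_).2
        (hasSum_fintype _)
      simp [h0]
  · rintro ⟨J, -, s, u, hs, hu, hs1, hAu, h⟩ B hB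
    have hsA : HasSum (fun j => (s j : 𝕜) * inner 𝕜 (A (u j)) (A (u j)))
        ((‖A‖ ^ 2 : ℝ) : 𝕜) := by
      have h1 : HasSum (fun j => ((s j * ‖A‖ ^ 2 : ℝ) : 𝕜)) ((1 * ‖A‖ ^ 2 : ℝ) : 𝕜) :=
        RCLike.hasSum_ofReal 𝕜 |>.2 (hs1.mul_right _)
      rw [one_mul] at h1
      convert! h1 using 2 with j
      have h2 : inner 𝕜 (u j) (u j) = (1 : 𝕜) := by
        rw [inner_self_eq_norm_sq_to_K, hu.1 j, RCLike.ofReal_one, one_pow]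
      rw [← adjoint_inner_right, hAu, inner_smul_right, h2, mul_one, RCLike.ofReal_mul]
    have hsum := hsA.add (h B hB)
    rw [add_zero] at hsum
    have hre := RCLike.hasSum_re 𝕜 hsum
    -- Averaging `re ⟪A u, (A + B) u⟫ ≤ ‖A‖ * ‖A + B‖` over the `u j` gives `‖A‖ ^ 2` on the left.
    have hle := hasSum_le (fun j => ?_) hre (hs1.mul_right (‖A‖ * ‖A + B‖))
    · rw [RCLike.ofReal_re, one_mul, sq] at hle
      exact le_of_mul_le_mul_left hle hA0
    · rw [← mul_add, ← inner_add_right, RCLike.re_ofReal_mul]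
      refine mul_le_mul_of_nonneg_left ?_ (hs j).le
      have h1 := A.le_opNorm (u j)
      have h2 := (A + B).le_opNorm (u j)
      rw [hu.1 j, mul_one] at h1 h2
      calc RCLike.re (inner 𝕜 (A (u j)) (A (u j) + B (u j)))
          ≤ ‖A (u j)‖ * ‖(A + B) (u j)‖ := re_inner_le_norm _ _
        _ ≤ _ := by gcongr
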